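/- Let $N,K\ge 1$ be integers, $\mu\in(-1,1)$, $P>0$ and $Q_{th}\ge 0$. Consider a user whose receiver (a fluid antenna) has $K$ ports and which is served by $N$ access points, each transmitting with power $P$. The complex channel gain from access point $m$ to port $k$ is $$g_k^{(m)}=\bigl(\sqrt{1-\mu^2}\,x_k^{(m)}+\mu x_0^{(m)}\bigr)+\mathrm j\bigl(\sqrt{1-\mu^2}\,y_k^{(m)}+\mu y_0^{(m)}\bigr),\qquad 1\le m\le N,\ 1\le k\le K,$$ where all the variables $x_0^{(m)},\dots,x_K^{(m)},y_0^{(m)},\dots,y_K^{(m)}$, $1\le m\le N$, are independent Gaussian random variables with mean $0$ and variance $1$. The power harvested at port $k$ is $Q_k=P\sum_{m=1}^N|g_k^{(m)}|^2$, and the user selects a port $k^*\in\arg\max_k Q_k$. Put $$Y_k=\sum_{m=1}^N\Bigl[\bigl(x_k^{(m)}+\tfrac{\mu}{\sqrt{1-\mu^2}}x_0^{(m)}\bigr)^2+\bigl(y_k^{(m)}+\tfrac{\mu}{\sqrt{1-\mu^2}}y_0^{(m)}\bigr)^2\Bigr].$$ Then the outage probability $\epsilon_{WET}=\Pr(Q_{k^*}<Q_{th})$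 of the wireless energy transfer satisfies $$\epsilon_{WET}=\Pr\Bigl(\max_{1\le k\le K}(1-\mu^2)P\,Y_k<Q_{th}\Bigr)=\int_0^\infty\frac{r^{N-1}e^{-r/2}}{2^N\Gamma(N)}\Bigl[1-Q_N\Bigl(\sqrt{\tfrac{\mu^2 r}{1-\mu^2}},\sqrt{\tfrac{Q_{th}}{P(1-\mu^2)}}\Bigr)\Bigr]^K\,dr,$$ where the integrand is integrable and $Q_N$ is the Marcum Q-function of order $N$: for $a>0$, $b\ge 0$, $$Q_N(a,b)=\int_b^\infty x\Bigl(\frac xa\Bigr)^{N-1}e^{-(x^2+a^2)/2}I_{N-1}(ax)\,dx,\qquad I_n(z)=\sum_{j\ge 0}\frac{(z/2)^{2j+n}}{j!\,(j+n)!},$$ and $Q_N(0,b)=\lim_{a\to 0^+}Q_N(a,b)=\int_b^\infty \frac{x^{2N-1}e^{-x^2/2}}{2^{N-1}(N-1)!}\,dx$. -/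

import Mathlib

open MeasureTheory ProbabilityTheory Set

noncomputable section

namespace FAMA

/-- The modified Bessel function of the first kind of integer order `n`,
`I_n(z) = ∑ (z/2)^(2j+n) / (j! (j+n)!)`. -/
def besselI (n : ℕ) (z : ℝ) : ℝ :=
  ∑' j : ℕ, (z / 2) ^ (2 * j + n) / ((j.factorial : ℝ) * ((j + n).factorial : ℝ))

/-- The generalized Marcum Q-function `Q_M(a, b)` of order `M ≥ 1`, for `a, b ≥ 0`:
`Q_M(a, b) = ∫_b^∞ x (x/a)^(M-1) exp(-(x²+a²)/2) I_{M-1}(a x) dx` if `a ≠ 0`. At `a = 0`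
the integrand is, as usual, read as its limit as `a → 0`, which is
`x^(2M-1) exp(-x²/2) / (2^(M-1) (M-1)!)`. -/
def marcumQ (M : ℕ) (a b : ℝ) : ℝ :=
  if a = 0 then
    ∫ x in Ioi b, x ^ (2 * M - 1) * Real.exp (-x ^ 2 / 2)
      / (2 ^ (M - 1) * ((M - 1).factorial : ℝ))
  else
    ∫ x in Ioi b, x * (x / a) ^ (M - 1) * Real.exp (-(x ^ 2 + a ^ 2) / 2)
      * besselI (M - 1) (a * x)

variable {Ω : Type*} {N K : ℕ}

/-- All the real variables `x_0, …, x_K` and `y_0, …, y_K` of all `N` access points, as a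
single family. Index `0` in `Fin (K + 1)` is the variable shared by the ports. -/
def allVars (x y : Fin N → Fin (K + 1) → Ω → ℝ) :
    (Fin N × Fin (K + 1)) ⊕ (Fin N × Fin (K + 1)) → Ω → ℝ
  | Sum.inl s => x s.1 s.2
  | Sum.inr s => y s.1 s.2

/-- The variables that generate the channel are mutually independent and standard normal. -/
structure IsChannel [MeasurableSpace Ω] (Pr : Measure Ω)
    (x y : Fin N → Fin (K + 1) → Ω → ℝ) : Prop where
  law : ∀ s, HasLaw (allVars x y s) (gaussianReal 0 1) Pr
  indep : iIndepFun (allVars x y) Pr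

/-- The complex channel gain between access point `m` and port `k` of the user. -/
def gain (μ : ℝ) (x y : Fin N → Fin (K + 1) → Ω → ℝ) (m : Fin N) (k : Fin K) (ω : Ω) : ℂ :=
  ((√(1 - μ ^ 2) * x m k.succ ω + μ * x m 0 ω : ℝ) : ℂ)
    + Complex.I * ((√(1 - μ ^ 2) * y m k.succ ω + μ * y m 0 ω : ℝ) : ℂ)

/-- The power harvested at port `k`, when access point `m` transmits with power `p m`. -/
def harvestedPower (μ : ℝ) (p : Fin N → ℝ) (x y : Fin N → Fin (K + 1) → Ω → ℝ)
    (k : Fin K) (ω : Ω) : ℝ :=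
  ∑ m, p m * ‖gain μ x y m k ω‖ ^ 2

/-- The normalized port power `Y_k`. -/
def normPower (μ : ℝ) (x y : Fin N → Fin (K + 1) → Ω → ℝ) (k : Fin K) (ω : Ω) : ℝ :=
  ∑ m, ((x m k.succ ω + μ / √(1 - μ ^ 2) * x m 0 ω) ^ 2
    + (y m k.succ ω + μ / √(1 - μ ^ 2) * y m 0 ω) ^ 2)

/-- `kstar` selects, for every outcome, a port that maximizes the harvested power. -/
def IsBestPort (μ : ℝ) (p : Fin N → ℝ) (x y : Fin N → Fin (K + 1) → Ω → ℝ)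
    (kstar : Ω → Fin K) : Prop :=
  ∀ ω k, harvestedPower μ p x y k ω ≤ harvestedPower μ p x y (kstar ω) ω

/-- The outage probability of the wireless energy transfer: the probability that the power
harvested at the selected port is lower than the threshold. -/
def wetOutage [MeasurableSpace Ω] (Pr : Measure Ω) (μ : ℝ) (p : Fin N → ℝ)
    (x y : Fin N → Fin (K + 1) → Ω → ℝ) (kstar : Ω → Fin K) (Qth : ℝ) : ℝ :=
  Pr.real {ω | harvestedPower μ p x y (kstar ω) ω < Qth}

end FAMA

end

/-!
Given the shared variables `x₀, y₀`, the normalized port powers `Y_k` are i.i.d. sums of squares of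
`2 N` Gaussian variables of variance `1`, hence noncentral chi-square with `2 N` degrees of freedom
and noncentrality `μ² r / (1 - μ²)`, where `r` is the squared length of `(x₀, y₀)`. Their
distribution function is `1 - Q_N`: expanding the Bessel function term by term turns the Marcum
integrand into a Poisson mixture of gamma densities, and this mixture has the moment generating
function of the sum of squares near `0`. The ports being conditionally independent, the `K`-th power
of `1 - Q_N` is averaged over `r`, which is chi-square with `2 N` degrees of freedom.
-/

noncomputable section

namespace FAMA

open scoped ENNReal NNReal Topology

/-- The moment generating function `t ↦ ∫ exp (t x) dρ` of a law `ρ`, with values in `[0, ∞]`, so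
that it is computed without integrability side conditions (`mgf` is `0` where it diverges). -/
def lmgf (ρ : Measure ℝ) (t : ℝ) : ℝ≥0∞ :=
  ∫⁻ x, ENNReal.ofReal (Real.exp (t * x)) ∂ρ

theorem mgf_id_eq_toReal_lmgf (ρ : Measure ℝ) (t : ℝ) : mgf id ρ t = (lmgf ρ t).toReal :=
  integral_eq_lintegral_of_nonneg_ae (ae_of_all _ fun _ => (Real.exp_pos _).le) (by fun_prop)

theorem mem_integrableExpSet_id {ρ : Measure ℝ} {t : ℝ} (h : lmgf ρ t ≠ ∞) :
    t ∈ integrableExpSet id ρ :=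
  (lintegral_ofReal_ne_top_iff_integrable (by fun_prop)
    (ae_of_all _ fun _ => (Real.exp_pos _).le)).1 h

theorem eq_of_lmgf_eventuallyEq {ρ σ : Measure ℝ} [IsFiniteMeasure ρ] [IsFiniteMeasure σ]
    (h : lmgf ρ =ᶠ[𝓝 0] lmgf σ) (hfin : ∀ᶠ t in 𝓝 0, lmgf ρ t ≠ ∞) : ρ = σ := by
  let A := interior (integrableExpSet id ρ) ∩ interior (integrableExpSet id σ)
  have hρ : 0 ∈ interior (integrableExpSet id ρ) :=
    mem_interior_iff_mem_nhds.2 (hfin.mono fun t => mem_integrableExpSet_id)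
  have hσ : 0 ∈ interior (integrableExpSet id σ) :=
    mem_interior_iff_mem_nhds.2 <| by
      filter_upwards [h, hfin] with t ht ht' using mem_integrableExpSet_id (ht ▸ ht')
  have hconn : IsPreconnected {z : ℂ | z.re ∈ A} :=
    ((convex_integrableExpSet.interior.inter convex_integrableExpSet.interior).linear_preimage
      Complex.reLm).isPreconnected
  have hreal : ∃ᶠ z in 𝓝[≠] (0 : ℂ), complexMGF id ρ z = complexMGF id σ z := by
    have hev : ∀ᶠ t : ℝ in 𝓝[≠] 0, complexMGF id ρ t = complexMGF id σ t := by
      filter_upwards [nhdsWithin_le_nhds h] with t ht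
      rw [complexMGF_ofReal, complexMGF_ofReal, mgf_id_eq_toReal_lmgf, mgf_id_eq_toReal_lmgf, ht]
    have htend : Filter.Tendsto (fun t : ℝ => (t : ℂ)) (𝓝[≠] 0) (𝓝[≠] ((0 : ℝ) : ℂ)) :=
      Complex.continuous_ofReal.continuousWithinAt.tendsto_nhdsWithin
        fun t ht => by simpa using ht
    simpa using htend.frequently hev.frequently
  have heq : EqOn (complexMGF id ρ) (complexMGF id σ) {z | z.re ∈ A} :=
    AnalyticOnNhd.eqOn_of_preconnected_of_frequently_eq
      (analyticOnNhd_complexMGF.mono fun z hz => hz.1)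
      (analyticOnNhd_complexMGF.mono fun z hz => hz.2) hconn
      (by simpa [A] using ⟨hρ, hσ⟩) hreal
  refine Measure.ext_of_charFun (funext fun t => ?_)
  rw [← complexMGF_id_mul_I, ← complexMGF_id_mul_I]
  exact heq (by simpa [A] using ⟨hρ, hσ⟩)

/-! ### Gamma and Poisson laws -/

theorem gammaPDFReal_natCast_succ (n : ℕ) (r : ℝ) {x : ℝ} (hx : 0 ≤ x) :
    gammaPDFReal (n + 1 : ℕ) r x = r ^ (n + 1) / n.factorial * x ^ n * Real.exp (-(r * x)) := by
  rw [gammaPDFReal, if_pos hx, Real.rpow_natCast, Nat.cast_add_one, Real.Gamma_nat_eq_factorial,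
    add_sub_cancel_right, Real.rpow_natCast]

theorem measurable_gammaPDF (a r : ℝ) : Measurable (gammaPDF a r) :=
  (measurable_gammaPDFReal a r).ennreal_ofReal

theorem gammaMeasure_eq_withDensity_restrict_Ioi (a r : ℝ) :
    gammaMeasure a r = (volume.restrict (Ioi 0)).withDensity (gammaPDF a r) := by
  rw [gammaMeasure, ← withDensity_indicator measurableSet_Ioi]
  refine withDensity_congr_ae ?_
  filter_upwards [Measure.ae_ne volume 0] with x hx
  rcases hx.lt_or_gt with h | h
  · rw [indicator_of_notMem (notMem_Ioi.2 h.le), gammaPDF_of_neg h]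
  · rw [indicator_of_mem (mem_Ioi.2 h)]

theorem setIntegral_gammaPDFReal_mul {a r : ℝ} (ha : 0 < a) (hr : 0 < r) (f : ℝ → ℝ) :
    ∫ x in Ioi 0, gammaPDFReal a r x * f x = ∫ x, f x ∂gammaMeasure a r := by
  rw [gammaMeasure_eq_withDensity_restrict_Ioi, integral_withDensity_eq_integral_toReal_smul
    (measurable_gammaPDF a r) (ae_of_all _ fun _ => ENNReal.ofReal_lt_top)]
  simp only [gammaPDF, ENNReal.toReal_ofReal (gammaPDFReal_nonneg ha hr _), smul_eq_mul]

theorem integrableOn_gammaPDFReal_mul_iff {a r : ℝ} (ha : 0 < a) (hr : 0 < r) {f : ℝ → ℝ} :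
    IntegrableOn (fun x => gammaPDFReal a r x * f x) (Ioi 0) ↔ Integrable f (gammaMeasure a r) := by
  rw [gammaMeasure_eq_withDensity_restrict_Ioi, integrable_withDensity_iff_integrable_smul'
    (measurable_gammaPDF a r) (ae_of_all _ fun _ => ENNReal.ofReal_lt_top)]
  simp only [gammaPDF, ENNReal.toReal_ofReal (gammaPDFReal_nonneg ha hr _), smul_eq_mul,
    IntegrableOn]

theorem lmgf_gammaMeasure {a r t : ℝ} (ha : 0 < a) (hr : 0 < r) (ht : t < r) :
    lmgf (gammaMeasure a r) t = ENNReal.ofReal ((r / (r - t)) ^ a) := by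
  have hrt : 0 < r - t := sub_pos.2 ht
  have htilt (x : ℝ) : gammaPDF a r x * ENNReal.ofReal (Real.exp (t * x))
      = ENNReal.ofReal ((r / (r - t)) ^ a) * gammaPDF a (r - t) x := by
    rw [gammaPDF, gammaPDF, ← ENNReal.ofReal_mul (gammaPDFReal_nonneg ha hr x),
      ← ENNReal.ofReal_mul (by positivity)]
    unfold gammaPDFReal
    split_ifs
    · rw [Real.div_rpow hr.le hrt.le, show -((r - t) * x) = -(r * x) + t * x by ring,
        Real.exp_add]
      field_simp
    · simp
  rw [lmgf, gammaMeasure,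
    lintegral_withDensity_eq_lintegral_mul _ (measurable_gammaPDF a r) (by fun_prop)]
  simp only [Pi.mul_apply, htilt]
  rw [lintegral_const_mul _ (measurable_gammaPDF a (r - t)), lintegral_gammaPDF_eq_one ha hrt,
    mul_one]

theorem lintegral_poissonMeasure (r : ℝ≥0) (f : ℕ → ℝ≥0∞) :
    ∫⁻ n, f n ∂poissonMeasure r
      = ∑' n : ℕ, ENNReal.ofReal (Real.exp (-r) * r ^ n / n.factorial) * f n := by
  simp only [poissonMeasure, lintegral_sum_measure, lintegral_smul_measure, lintegral_dirac,
    smul_eq_mul]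

theorem poissonMeasure_zero : poissonMeasure 0 = Measure.dirac 0 := by
  refine Measure.ext_of_lintegral _ fun f _ => ?_
  rw [lintegral_poissonMeasure, lintegral_dirac, tsum_eq_single 0 fun n hn => by simp [hn]]
  simp

theorem lintegral_pow_poissonMeasure (r : ℝ≥0) {s : ℝ} (hs : 0 ≤ s) :
    ∫⁻ n, ENNReal.ofReal (s ^ n) ∂poissonMeasure r = ENNReal.ofReal (Real.exp (r * (s - 1))) := by
  have hsum : HasSum (fun n : ℕ => Real.exp (-r) * r ^ n / n.factorial * s ^ n)
      (Real.exp (r * (s - 1))) := by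
    have h := (NormedSpace.expSeries_div_hasSum_exp (r * s : ℝ)).mul_left (Real.exp (-r))
    rw [← Real.exp_eq_exp_ℝ, ← Real.exp_add] at h
    convert! h using 1
    · ext n; ring
    · ring_nf
  rw [lintegral_poissonMeasure, ← hsum.tsum_eq,
    ENNReal.ofReal_tsum_of_nonneg (fun n => by positivity) hsum.summable]
  exact tsum_congr fun n => (ENNReal.ofReal_mul (by positivity)).symm

/-! ### The noncentral chi-square law -/

/-- The noncentral chi-square law with `d` degrees of freedom and noncentrality `l`, encoded as the
mixture of the chi-square laws with `d + 2 j` degrees of freedom over a Poisson variable `j` of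
mean `l / 2`. The value is meaningful for `0 < d` and `0 ≤ l`; a negative `l` is read as `0`. -/
def noncentralChiSq (d l : ℝ) : Measure ℝ :=
  (poissonMeasure (l / 2).toNNReal).bind fun j => gammaMeasure (d / 2 + j) (1 / 2)

theorem noncentralChiSq_zero (d : ℝ) : noncentralChiSq d 0 = gammaMeasure (d / 2) (1 / 2) := by
  simp [noncentralChiSq, poissonMeasure_zero, Measure.dirac_bind Measurable.of_discrete]

theorem measurable_noncentralChiSq_apply (d : ℝ) {s : Set ℝ} (hs : MeasurableSet s) :
    Measurable fun l => noncentralChiSq d l s := by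
  simp only [noncentralChiSq, Measure.bind_apply hs Measurable.of_discrete.aemeasurable,
    lintegral_poissonMeasure]
  exact .tsum fun j => by fun_prop

theorem lintegral_noncentralChiSq (d l : ℝ) {f : ℝ → ℝ≥0∞} (hf : Measurable f) :
    ∫⁻ x, f x ∂noncentralChiSq d l = ∫⁻ j : ℕ, ∫⁻ x, f x ∂gammaMeasure (d / 2 + j) (1 / 2)
      ∂poissonMeasure (l / 2).toNNReal :=
  Measure.lintegral_bind Measurable.of_discrete.aemeasurable hf.aemeasurable

theorem isProbabilityMeasure_noncentralChiSq {d : ℝ} (hd : 0 < d) (l : ℝ) :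
    IsProbabilityMeasure (noncentralChiSq d l) :=
  isProbabilityMeasure_bind Measurable.of_discrete.aemeasurable <|
    ae_of_all _ fun _ => isProbabilityMeasure_gammaMeasure (by positivity) (by norm_num)

theorem lmgf_noncentralChiSq {d l t : ℝ} (hd : 0 < d) (hl : 0 ≤ l) (ht : t < 1 / 2) :
    lmgf (noncentralChiSq d l) t
      = ENNReal.ofReal ((1 - 2 * t)⁻¹ ^ (d / 2) * Real.exp (l * (t / (1 - 2 * t)))) := by
  have hs : 0 < 1 - 2 * t := by linarith
  have hgamma (j : ℕ) : lmgf (gammaMeasure (d / 2 + j) (1 / 2)) t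
      = ENNReal.ofReal ((1 - 2 * t)⁻¹ ^ (d / 2)) * ENNReal.ofReal ((1 - 2 * t)⁻¹ ^ j) := by
    rw [lmgf_gammaMeasure (by positivity) (by norm_num) ht, ← ENNReal.ofReal_mul (by positivity),
      ← Real.rpow_add_natCast (by positivity)]
    congr 2
    field_simp
  have hexp : ((l / 2).toNNReal : ℝ) * ((1 - 2 * t)⁻¹ - 1) = l * (t / (1 - 2 * t)) := by
    rw [Real.coe_toNNReal _ (by positivity)]
    field_simp
    ring
  calc lmgf (noncentralChiSq d l) t
    _ = ∫⁻ j : ℕ, lmgf (gammaMeasure (d / 2 + j) (1 / 2)) t ∂poissonMeasure (l / 2).toNNReal :=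
      lintegral_noncentralChiSq d l (by fun_prop)
    _ = ENNReal.ofReal ((1 - 2 * t)⁻¹ ^ (d / 2) * Real.exp (l * (t / (1 - 2 * t)))) := by
      simp only [hgamma]
      rw [lintegral_const_mul _ Measurable.of_discrete,
        lintegral_pow_poissonMeasure _ (by positivity), ← ENNReal.ofReal_mul (by positivity), hexp]

theorem integrable_real_noncentralChiSq_pow {d : ℝ} (hd : 0 < d) (c : ℝ) {s : Set ℝ}
    (hs : MeasurableSet s) (n : ℕ) (ρ : Measure ℝ) [IsFiniteMeasure ρ] :
    Integrable (fun r => (noncentralChiSq d (c * r)).real s ^ n) ρ := by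
  have (l : ℝ) := isProbabilityMeasure_noncentralChiSq hd l
  have hmeas : Measurable fun r => (noncentralChiSq d (c * r)).real s ^ n :=
    ((measurable_noncentralChiSq_apply d hs).comp
      (measurable_const_mul c)).ennreal_toReal.pow_const n
  refine .of_bound hmeas.aestronglyMeasurable 1 (ae_of_all _ fun r => ?_)
  rw [Real.norm_of_nonneg (by positivity)]
  exact pow_le_one₀ measureReal_nonneg measureReal_le_one

theorem lmgf_map_add_const_sq_gaussianReal (w : ℝ) {t : ℝ} (ht : t < 1 / 2) :
    lmgf ((gaussianReal 0 1).map fun x => (x + w) ^ 2) t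
      = ENNReal.ofReal ((1 - 2 * t)⁻¹ ^ (1 / 2 : ℝ) * Real.exp (w ^ 2 * (t / (1 - 2 * t)))) := by
  have hs : 0 < 1 - 2 * t := by linarith
  obtain ⟨v, hv⟩ : ∃ v : ℝ≥0, (v : ℝ) = (1 - 2 * t)⁻¹ := ⟨⟨_, (inv_pos.2 hs).le⟩, rfl⟩
  have hv0 : v ≠ 0 := by
    rw [← NNReal.coe_ne_zero, hv]; positivity
  have htilt (x : ℝ) : gaussianPDF 0 1 x * ENNReal.ofReal (Real.exp (t * (x + w) ^ 2))
      = ENNReal.ofReal ((1 - 2 * t)⁻¹ ^ (1 / 2 : ℝ) * Real.exp (w ^ 2 * (t / (1 - 2 * t))))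
        * gaussianPDF (2 * t * w / (1 - 2 * t)) v x := by
    rw [gaussianPDF, gaussianPDF, ← ENNReal.ofReal_mul (gaussianPDFReal_nonneg _ _ _),
      ← ENNReal.ofReal_mul (by positivity)]
    congr 1
    rw [gaussianPDFReal, gaussianPDFReal, hv, NNReal.coe_one, mul_assoc,
      mul_mul_mul_comm, ← Real.exp_add, ← Real.exp_add]
    congr 1
    · rw [← Real.sqrt_eq_rpow, Real.sqrt_mul (by positivity) (1 - 2 * t)⁻¹, Real.sqrt_inv]
      field_simp
    · congr 1
      field_simp
      ring
  rw [lmgf, lintegral_map (by fun_prop) (by fun_prop), gaussianReal_of_var_ne_zero _ one_ne_zero,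
    lintegral_withDensity_eq_lintegral_mul _ (by fun_prop) (by fun_prop)]
  simp only [Pi.mul_apply, htilt]
  rw [lintegral_const_mul _ (by fun_prop), lintegral_gaussianPDF_eq_one _ hv0, mul_one]

theorem lmgf_map_sum_sq_pi_gaussianReal {ι : Type*} [Fintype ι] (w : ι → ℝ) {t : ℝ}
    (ht : t < 1 / 2) :
    lmgf ((Measure.pi fun _ : ι => gaussianReal 0 1).map fun z => ∑ i, (z i + w i) ^ 2) t
      = ENNReal.ofReal ((1 - 2 * t)⁻¹ ^ (Fintype.card ι / 2 : ℝ)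
        * Real.exp ((∑ i, w i ^ 2) * (t / (1 - 2 * t)))) := by
  have hs : 0 < 1 - 2 * t := by linarith
  have hcoord (i : ι) :
      ∫⁻ z, ENNReal.ofReal (Real.exp (t * (z i + w i) ^ 2))
          ∂Measure.pi (fun _ : ι => gaussianReal 0 1)
        = ENNReal.ofReal
          ((1 - 2 * t)⁻¹ ^ (1 / 2 : ℝ) * Real.exp (w i ^ 2 * (t / (1 - 2 * t)))) := by
    rw [← lmgf_map_add_const_sq_gaussianReal (w i) ht, lmgf,
      lintegral_map (by fun_prop) (by fun_prop)]
    exact (measurePreserving_eval (fun _ : ι => gaussianReal 0 1) i).lintegral_comp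
      (f := fun x => ENNReal.ofReal (Real.exp (t * (x + w i) ^ 2))) (by fun_prop)
  have hindep : iIndepFun (fun i (z : ι → ℝ) => ENNReal.ofReal (Real.exp (t * (z i + w i) ^ 2)))
      (Measure.pi fun _ : ι => gaussianReal 0 1) :=
    iIndepFun_pi (X := fun i x => ENNReal.ofReal (Real.exp (t * (x + w i) ^ 2)))
      fun i => by fun_prop
  rw [lmgf, lintegral_map (by fun_prop) (by fun_prop)]
  simp only [Finset.mul_sum, Real.exp_sum,
    ENNReal.ofReal_prod_of_nonneg fun _ _ => (Real.exp_pos _).le]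
  rw [lintegral_prod_eq_prod_lintegral_of_indepFun _ _ hindep fun i => by fun_prop]
  simp only [hcoord]
  rw [← ENNReal.ofReal_prod_of_nonneg fun _ _ => by positivity, Finset.prod_mul_distrib,
    Finset.prod_const, Finset.card_univ, ← Real.rpow_mul_natCast (by positivity), ← Real.exp_sum,
    ← Finset.sum_mul, one_div_mul_eq_div]

theorem map_sum_sq_pi_gaussianReal {ι : Type*} [Fintype ι] [Nonempty ι] (w : ι → ℝ) :
    (Measure.pi fun _ : ι => gaussianReal 0 1).map (fun z => ∑ i, (z i + w i) ^ 2)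
      = noncentralChiSq (Fintype.card ι) (∑ i, w i ^ 2) := by
  have hcard : (0 : ℝ) < Fintype.card ι := by exact_mod_cast Fintype.card_pos
  have := isProbabilityMeasure_noncentralChiSq hcard (∑ i, w i ^ 2)
  have hnear : ∀ᶠ t : ℝ in 𝓝 0, t < 1 / 2 := eventually_lt_nhds (by norm_num)
  refine eq_of_lmgf_eventuallyEq ?_ ?_
  · filter_upwards [hnear] with t ht
    rw [lmgf_map_sum_sq_pi_gaussianReal w ht, lmgf_noncentralChiSq hcard (by positivity) ht]
  · filter_upwards [hnear] with t ht
    rw [lmgf_map_sum_sq_pi_gaussianReal w ht]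
    exact ENNReal.ofReal_ne_top

theorem map_sum_sq_pi_gaussianReal_zero (ι : Type*) [Fintype ι] [Nonempty ι] :
    (Measure.pi fun _ : ι => gaussianReal 0 1).map (fun z => ∑ i, z i ^ 2)
      = gammaMeasure (Fintype.card ι / 2) (1 / 2) := by
  simpa [noncentralChiSq_zero] using map_sum_sq_pi_gaussianReal (fun _ : ι => (0 : ℝ))

/-! ### Densities and the Marcum function -/

/-- The density of `noncentralChiSq d l`: the same Poisson mixture, taken of the gamma densities. -/
def noncentralChiSqPDF (d l x : ℝ) : ℝ≥0∞ :=
  ∫⁻ j : ℕ, gammaPDF (d / 2 + j) (1 / 2) x ∂poissonMeasure (l / 2).toNNReal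

theorem measurable_noncentralChiSqPDF (d l : ℝ) : Measurable (noncentralChiSqPDF d l) := by
  unfold noncentralChiSqPDF
  simp only [lintegral_poissonMeasure]
  exact .tsum fun j => (measurable_gammaPDF _ _).const_mul _

theorem noncentralChiSq_eq_withDensity (d l : ℝ) :
    noncentralChiSq d l = volume.withDensity (noncentralChiSqPDF d l) := by
  ext s hs
  rw [noncentralChiSq, Measure.bind_apply hs Measurable.of_discrete.aemeasurable,
    withDensity_apply _ hs]
  unfold noncentralChiSqPDF
  simp only [gammaMeasure, lintegral_poissonMeasure, withDensity_apply _ hs,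
    ← lintegral_const_mul _ (measurable_gammaPDF _ _)]
  exact (lintegral_tsum fun j => ((measurable_gammaPDF _ _).const_mul _).aemeasurable).symm

theorem toReal_noncentralChiSqPDF {d l : ℝ} (hd : 0 < d) (hl : 0 ≤ l) (x : ℝ) :
    (noncentralChiSqPDF d l x).toReal = ∑' j : ℕ,
      Real.exp (-(l / 2)) * (l / 2) ^ j / j.factorial * gammaPDFReal (d / 2 + j) (1 / 2) x := by
  rw [noncentralChiSqPDF, lintegral_poissonMeasure, Real.coe_toNNReal _ (by positivity),
    ENNReal.tsum_toReal_eq fun j => by simp [gammaPDF, ENNReal.mul_ne_top]]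
  refine tsum_congr fun j => ?_
  rw [ENNReal.toReal_mul, ENNReal.toReal_ofReal (by positivity), gammaPDF,
    ENNReal.toReal_ofReal (gammaPDFReal_nonneg (by positivity) (by norm_num) x)]

theorem toReal_noncentralChiSqPDF_zero {d : ℝ} (hd : 0 < d) (x : ℝ) :
    (noncentralChiSqPDF d 0 x).toReal = gammaPDFReal (d / 2) (1 / 2) x := by
  simp [noncentralChiSqPDF, poissonMeasure_zero, gammaPDF,
    ENNReal.toReal_ofReal (gammaPDFReal_nonneg (half_pos hd) (inv_pos.2 two_pos) x)]

theorem real_noncentralChiSq {d l : ℝ} (hd : 0 < d) {s : Set ℝ} (hs : MeasurableSet s) :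
    (noncentralChiSq d l).real s = ∫ x in s, (noncentralChiSqPDF d l x).toReal := by
  have := isProbabilityMeasure_noncentralChiSq hd l
  have happly : noncentralChiSq d l s = ∫⁻ x in s, noncentralChiSqPDF d l x := by
    rw [noncentralChiSq_eq_withDensity, withDensity_apply _ hs]
  have hmeas := (measurable_noncentralChiSqPDF d l).aemeasurable (μ := volume.restrict s)
  rw [integral_toReal hmeas (ae_lt_top' hmeas (happly ▸ measure_ne_top _ s)), measureReal_def,
    happly]

theorem setIntegral_Ioi_two_mul_comp_sq (f : ℝ → ℝ) {b : ℝ} (hb : 0 ≤ b) :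
    ∫ x in Ioi b, 2 * x * f (x ^ 2) = ∫ y in Ioi (b ^ 2), f y := by
  have himage : (fun x : ℝ => x ^ 2) '' Ioi b = Ioi (b ^ 2) := by
    ext y
    refine ⟨?_, fun hy => ⟨√y, Real.lt_sqrt_of_sq_lt hy, Real.sq_sqrt ((sq_nonneg b).trans hy.le)⟩⟩
    rintro ⟨x, hx, rfl⟩
    exact pow_lt_pow_left₀ hx hb two_ne_zero
  have hinj : InjOn (fun x : ℝ => x ^ 2) (Ioi b) := fun x hx y hy h =>
    (pow_left_inj₀ (hb.trans hx.le) (hb.trans hy.le) two_ne_zero).1 h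
  have hderiv (x : ℝ) (_ : x ∈ Ioi b) : HasDerivWithinAt (fun x => x ^ 2) (2 * x) (Ioi b) x := by
    simpa using (hasDerivAt_pow 2 x).hasDerivWithinAt
  rw [← himage, integral_image_eq_integral_abs_deriv_smul measurableSet_Ioi hderiv hinj]
  refine setIntegral_congr_fun measurableSet_Ioi fun x hx => ?_
  rw [abs_of_nonneg (by linarith [hb.trans hx.le]), smul_eq_mul]

theorem marcum_integrand_eq (n : ℕ) {a x : ℝ} (ha : a ≠ 0) :
    x * (x / a) ^ n * Real.exp (-(x ^ 2 + a ^ 2) / 2) * besselI n (a * x)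
      = 2 * x * (noncentralChiSqPDF (2 * (n + 1 : ℕ)) (a ^ 2) (x ^ 2)).toReal := by
  rw [toReal_noncentralChiSqPDF (by positivity) (by positivity), besselI, ← tsum_mul_left,
    ← tsum_mul_left]
  refine tsum_congr fun j => ?_
  have hshape : 2 * ((n + 1 : ℕ) : ℝ) / 2 + j = ((j + n + 1 : ℕ) : ℝ) := by
    push_cast; ring
  rw [hshape, gammaPDFReal_natCast_succ _ _ (sq_nonneg x),
    show -(x ^ 2 + a ^ 2) / 2 = -(a ^ 2 / 2) + -(1 / 2 * x ^ 2) by ring, Real.exp_add]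
  simp only [div_pow, one_pow]
  field_simp
  ring

theorem marcum_limit_integrand_eq (n : ℕ) (x : ℝ) :
    x ^ (2 * (n + 1) - 1) * Real.exp (-x ^ 2 / 2) / (2 ^ n * n.factorial)
      = 2 * x * (noncentralChiSqPDF (2 * (n + 1 : ℕ)) 0 (x ^ 2)).toReal := by
  rw [toReal_noncentralChiSqPDF_zero (by positivity), mul_div_cancel_left₀ _ two_ne_zero,
    gammaPDFReal_natCast_succ _ _ (sq_nonneg x), show 2 * (n + 1) - 1 = 2 * n + 1 by omega,
    show -x ^ 2 / 2 = -(1 / 2 * x ^ 2) by ring]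
  simp only [div_pow, one_pow]
  field_simp
  ring

theorem marcumQ_eq_real_noncentralChiSq {M : ℕ} (hM : M ≠ 0) (a : ℝ) {b : ℝ} (hb : 0 ≤ b) :
    marcumQ M a b = (noncentralChiSq (2 * M) (a ^ 2)).real (Ioi (b ^ 2)) := by
  obtain ⟨n, rfl⟩ := Nat.exists_eq_succ_of_ne_zero hM
  rw [real_noncentralChiSq (by positivity) measurableSet_Ioi,
    ← setIntegral_Ioi_two_mul_comp_sq _ hb, marcumQ]
  split_ifs with ha
  · simp only [ha, Nat.succ_eq_add_one, zero_pow two_ne_zero, Nat.add_sub_cancel,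
      marcum_limit_integrand_eq]
  · simp only [Nat.succ_eq_add_one, Nat.add_sub_cancel, marcum_integrand_eq n ha]

theorem one_sub_marcumQ {M : ℕ} (hM : M ≠ 0) (a : ℝ) {b : ℝ} (hb : 0 ≤ b) :
    1 - marcumQ M a b = (noncentralChiSq (2 * M) (a ^ 2)).real (Iio (b ^ 2)) := by
  have := isProbabilityMeasure_noncentralChiSq (d := 2 * M) (by positivity) (a ^ 2)
  have hnull : Iio (b ^ 2) =ᵐ[noncentralChiSq (2 * M) (a ^ 2)] Iic (b ^ 2) := by
    rw [noncentralChiSq_eq_withDensity]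
    exact Iio_ae_eq_Iic
  rw [marcumQ_eq_real_noncentralChiSq hM a hb, ← probReal_compl_eq_one_sub measurableSet_Ioi,
    compl_Ioi, measureReal_congr hnull]

/-! ### Conditioning on a shared variable -/

theorem pi_setOf_forall_succ_mem {α : Type*} [MeasurableSpace α] (ν : Measure α) [SigmaFinite ν]
    (K : ℕ) {s : Set (α × α)} (hs : MeasurableSet s) :
    Measure.pi (fun _ : Fin (K + 1) => ν) {z | ∀ k : Fin K, (z 0, z k.succ) ∈ s}
      = ∫⁻ u, ν (Prod.mk u ⁻¹' s) ^ K ∂ν := by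
  have hmeas : MeasurableSet {p : α × (Fin K → α) | ∀ k, (p.1, p.2 k) ∈ s} := by
    simp only [ofPred_forall]
    exact .iInter fun k => hs.preimage (by fun_prop)
  have hsection (u : α) : Measure.pi (fun _ : Fin K => ν) {v | ∀ k, (u, v k) ∈ s}
      = ν (Prod.mk u ⁻¹' s) ^ K := by
    have hbox : {v : Fin K → α | ∀ k, (u, v k) ∈ s} = univ.pi fun _ => Prod.mk u ⁻¹' s := by
      ext v; simp
    rw [hbox, Measure.pi_pi, Finset.prod_const, Finset.card_univ, Fintype.card_fin]
  have hsplit := (measurePreserving_piFinSuccAbove (fun _ : Fin (K + 1) => ν) 0).measure_preimage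
    hmeas.nullMeasurableSet
  simp only [← hsection]
  exact hsplit.trans (Measure.prod_apply hmeas)

theorem pi_gaussianReal_setOf_forall_sum_sq_lt (ι : Type*) [Fintype ι] [Nonempty ι] (K : ℕ)
    (c T : ℝ) :
    Measure.pi (fun _ : Fin (K + 1) => Measure.pi fun _ : ι => gaussianReal 0 1)
        {z | ∀ k : Fin K, ∑ i, (z k.succ i + c * z 0 i) ^ 2 < T}
      = ∫⁻ r, noncentralChiSq (Fintype.card ι) (c ^ 2 * r) (Iio T) ^ K
          ∂gammaMeasure (Fintype.card ι / 2) (1 / 2) := by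
  let s : Set ((ι → ℝ) × (ι → ℝ)) := {p | ∑ i, (p.2 i + c * p.1 i) ^ 2 < T}
  have hs : MeasurableSet s := measurableSet_lt (by fun_prop) measurable_const
  have hsection (u : ι → ℝ) : Measure.pi (fun _ : ι => gaussianReal 0 1) (Prod.mk u ⁻¹' s)
      = noncentralChiSq (Fintype.card ι) (c ^ 2 * ∑ i, u i ^ 2) (Iio T) := by
    simp only [Finset.mul_sum, ← mul_pow]
    rw [← map_sum_sq_pi_gaussianReal, Measure.map_apply (by fun_prop) measurableSet_Iio]
    rfl
  have hmeas : Measurable fun r => noncentralChiSq (Fintype.card ι) (c ^ 2 * r) (Iio T) ^ K :=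
    ((measurable_noncentralChiSq_apply _ measurableSet_Iio).comp (by fun_prop)).pow_const K
  rw [← map_sum_sq_pi_gaussianReal_zero, lintegral_map hmeas (by fun_prop)]
  simp only [← hsection]
  exact pi_setOf_forall_succ_mem _ K hs

/-! ### The channel -/

theorem hasLaw_pi_pi {Ω ι κ α : Type*} [MeasurableSpace Ω] [MeasurableSpace α] [Fintype ι]
    [Fintype κ] {X : ι → κ → Ω → α} {ν : Measure α} [IsProbabilityMeasure ν] {P : Measure Ω}
    (hX : ∀ i j, HasLaw (X i j) ν P) (h : iIndepFun (fun p : ι × κ => X p.1 p.2) P) :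
    HasLaw (fun ω i j => X i j ω) (Measure.pi fun _ => Measure.pi fun _ => ν) P := by
  have hcurry : MeasurePreserving (MeasurableEquiv.curry ι κ α) (Measure.pi fun _ => ν)
      (Measure.pi fun _ => Measure.pi fun _ => ν) :=
    ⟨by fun_prop, by simpa only [Measure.infinitePi_eq_pi] using
      Measure.infinitePi_map_curry fun (_ : ι) (_ : κ) => ν⟩
  exact hcurry.comp_hasLaw (h.hasLaw_pi fun p => hX p.1 p.2)

section Channel

variable {Ω : Type*} {N K : ℕ}

/-- The `2 N` variables of index `k`, with those of `x` on the left and those of `y` on the right;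
as in `allVars`, index `0` is the family shared by the ports. -/
def portVector (x y : Fin N → Fin (K + 1) → Ω → ℝ) (k : Fin (K + 1)) (i : Fin N ⊕ Fin N) :
    Ω → ℝ :=
  Sum.elim (fun m => x m k) (fun m => y m k) i

theorem normPower_eq_sum_portVector (μ : ℝ) (x y : Fin N → Fin (K + 1) → Ω → ℝ) (k : Fin K)
    (ω : Ω) :
    normPower μ x y k ω
      = ∑ i, (portVector x y k.succ i ω + μ / √(1 - μ ^ 2) * portVector x y 0 i ω) ^ 2 := by
  simp [normPower, portVector, Finset.sum_add_distrib]

theorem harvestedPower_eq {μ : ℝ} (hμ : |μ| < 1) (P : ℝ) (x y : Fin N → Fin (K + 1) → Ω → ℝ)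
    (k : Fin K) (ω : Ω) :
    harvestedPower μ (fun _ => P) x y k ω = (1 - μ ^ 2) * P * normPower μ x y k ω := by
  have hs : 0 < 1 - μ ^ 2 := sub_pos.2 ((sq_lt_one_iff_abs_lt_one μ).2 hμ)
  have hcoord (u u₀ : ℝ) : (√(1 - μ ^ 2) * u + μ * u₀) ^ 2
      = (1 - μ ^ 2) * (u + μ / √(1 - μ ^ 2) * u₀) ^ 2 := by
    rw [← Real.sq_sqrt hs.le, ← mul_pow, Real.sq_sqrt hs.le]
    field_simp
  have hnorm (u v : ℝ) : ‖(u : ℂ) + Complex.I * v‖ ^ 2 = u ^ 2 + v ^ 2 := by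
    rw [mul_comm, Complex.sq_norm, Complex.normSq_add_mul_I]
  simp only [harvestedPower, normPower, gain, hnorm, hcoord, Finset.mul_sum]
  exact Finset.sum_congr rfl fun m _ => by ring

variable [MeasurableSpace Ω] {x y : Fin N → Fin (K + 1) → Ω → ℝ}

theorem IsBestPort.wetOutage_eq {μ : ℝ} {p : Fin N → ℝ} {kstar : Ω → Fin K}
    (hk : IsBestPort μ p x y kstar) (Pr : Measure Ω) (Q : ℝ) :
    wetOutage Pr μ p x y kstar Q = Pr.real {ω | ∀ k, harvestedPower μ p x y k ω < Q} :=
  congrArg Pr.real <| Set.ext fun ω => ⟨fun h k => (hk ω k).trans_lt h, fun h => h (kstar ω)⟩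

variable {Pr : Measure Ω}

theorem IsChannel.hasLaw_portVector (hxy : IsChannel Pr x y) :
    HasLaw (fun ω k i => portVector x y k i ω)
      (Measure.pi fun _ => Measure.pi fun _ => gaussianReal 0 1) Pr := by
  let e : Fin (K + 1) × (Fin N ⊕ Fin N) ≃ (Fin N × Fin (K + 1)) ⊕ (Fin N × Fin (K + 1)) :=
    (Equiv.prodSumDistrib _ _ _).trans (Equiv.sumCongr (Equiv.prodComm _ _) (Equiv.prodComm _ _))
  have he (p : Fin (K + 1) × (Fin N ⊕ Fin N)) : portVector x y p.1 p.2 = allVars x y (e p) := by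
    obtain ⟨k, m | m⟩ := p <;> rfl
  refine hasLaw_pi_pi (fun k i => he (k, i) ▸ hxy.law _) ?_
  simp only [he]
  exact hxy.indep.precomp e.injective

theorem IsChannel.real_forall_normPower_lt [NeZero N] (hxy : IsChannel Pr x y) (μ T : ℝ) :
    Pr.real {ω | ∀ k, normPower μ x y k ω < T}
      = ∫ r, (noncentralChiSq (2 * N) ((μ / √(1 - μ ^ 2)) ^ 2 * r)).real (Iio T) ^ K
          ∂gammaMeasure N (1 / 2) := by
  have hmeas : MeasurableSet {z : Fin (K + 1) → Fin N ⊕ Fin N → ℝ |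
      ∀ k : Fin K, ∑ i, (z k.succ i + μ / √(1 - μ ^ 2) * z 0 i) ^ 2 < T} := by
    simp only [ofPred_forall]
    exact .iInter fun k => measurableSet_lt (by fun_prop) measurable_const
  have hN : (0 : ℝ) < 2 * N := by have := NeZero.pos N; positivity
  have hcard : (Fintype.card (Fin N ⊕ Fin N) : ℝ) = 2 * N := by simp [two_mul]
  have (l : ℝ) := isProbabilityMeasure_noncentralChiSq hN l
  simp only [normPower_eq_sum_portVector]
  rw [hxy.hasLaw_portVector.measureReal_eq hmeas, measureReal_def,
    pi_gaussianReal_setOf_forall_sum_sq_lt, hcard, mul_div_cancel_left₀ _ two_ne_zero]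
  simp only [measureReal_def, ← ENNReal.toReal_pow]
  refine (integral_toReal ?_ (ae_of_all _ fun r => ?_)).symm
  · exact (((measurable_noncentralChiSq_apply _ measurableSet_Iio).comp
      (measurable_const_mul _)).pow_const K).aemeasurable
  · exact ENNReal.pow_lt_top (measure_lt_top _ _)

end Channel

theorem gammaPDFReal_mul_real_noncentralChiSq_pow {N : ℕ} (hN : N ≠ 0) {μ : ℝ} (hμ : |μ| < 1)
    {T : ℝ} (hT : 0 ≤ T) (K : ℕ) {r : ℝ} (hr : 0 ≤ r) :
    gammaPDFReal N (1 / 2) r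
        * (noncentralChiSq (2 * N) ((μ / √(1 - μ ^ 2)) ^ 2 * r)).real (Iio T) ^ K
      = r ^ (N - 1) * Real.exp (-r / 2) / (2 ^ N * Real.Gamma N)
        * (1 - marcumQ N √(μ ^ 2 * r / (1 - μ ^ 2)) √T) ^ K := by
  have hs : 0 < 1 - μ ^ 2 := sub_pos.2 ((sq_lt_one_iff_abs_lt_one μ).2 hμ)
  have hl : (μ / √(1 - μ ^ 2)) ^ 2 * r = √(μ ^ 2 * r / (1 - μ ^ 2)) ^ 2 := by
    rw [Real.sq_sqrt (by positivity), div_pow, Real.sq_sqrt hs.le, div_mul_eq_mul_div]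
  rw [one_sub_marcumQ hN _ (Real.sqrt_nonneg T), Real.sq_sqrt hT, hl]
  congr 1
  obtain ⟨n, rfl⟩ := Nat.exists_eq_succ_of_ne_zero hN
  rw [gammaPDFReal_natCast_succ n _ hr, Nat.succ_eq_add_one, Nat.add_sub_cancel, Nat.cast_add_one,
    Real.Gamma_nat_eq_factorial, show -r / 2 = -(1 / 2 * r) by ring, div_pow, one_pow]
  field_simp

end FAMA

end

theorem theorem1 {Ω : Type*} [MeasurableSpace Ω] (Pr : Measure Ω) [IsProbabilityMeasure Pr]
    (N K : ℕ) [NeZero N] [NeZero K] (μ P Qth : ℝ) (hμ : |μ| < 1) (hP : 0 < P) (hQ : 0 ≤ Qth)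
    (x y : Fin N → Fin (K + 1) → Ω → ℝ) (hxy : FAMA.IsChannel Pr x y)
    (kstar : Ω → Fin K) (hk : FAMA.IsBestPort μ (fun _ => P) x y kstar) :
    FAMA.wetOutage Pr μ (fun _ => P) x y kstar Qth
        = Pr.real {ω | Finset.univ.sup' Finset.univ_nonempty
            (fun k : Fin K => (1 - μ ^ 2) * P * FAMA.normPower μ x y k ω) < Qth}
      ∧ IntegrableOn (fun r : ℝ =>
          r ^ (N - 1) * Real.exp (-r / 2) / (2 ^ N * Real.Gamma N)
            * (1 - FAMA.marcumQ N (√(μ ^ 2 * r / (1 - μ ^ 2)))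
                (√(Qth / (P * (1 - μ ^ 2))))) ^ K) (Ioi 0)
      ∧ FAMA.wetOutage Pr μ (fun _ => P) x y kstar Qth
        = ∫ r in Ioi (0 : ℝ),
          r ^ (N - 1) * Real.exp (-r / 2) / (2 ^ N * Real.Gamma N)
            * (1 - FAMA.marcumQ N (√(μ ^ 2 * r / (1 - μ ^ 2)))
                (√(Qth / (P * (1 - μ ^ 2))))) ^ K := by
  have hP' : 0 < P * (1 - μ ^ 2) := mul_pos hP (sub_pos.2 ((sq_lt_one_iff_abs_lt_one μ).2 hμ))
  have hN : (0 : ℝ) < N := by exact_mod_cast NeZero.pos N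
  have houtage : FAMA.wetOutage Pr μ (fun _ => P) x y kstar Qth
      = Pr.real {ω | ∀ k, (1 - μ ^ 2) * P * FAMA.normPower μ x y k ω < Qth} := by
    simp only [hk.wetOutage_eq, FAMA.harvestedPower_eq hμ]
  have hintegrand := fun (r : ℝ) (hr : r ∈ Ioi 0) =>
    FAMA.gammaPDFReal_mul_real_noncentralChiSq_pow (NeZero.ne N) hμ (div_nonneg hQ hP'.le) K hr.le
  refine ⟨?_, ?_, ?_⟩
  · simp only [houtage, Finset.sup'_lt_iff, Finset.mem_univ, true_imp_iff]
  · rw [← integrableOn_congr_fun hintegrand measurableSet_Ioi,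
      FAMA.integrableOn_gammaPDFReal_mul_iff hN one_half_pos]
    have := isProbabilityMeasure_gammaMeasure hN (one_half_pos (α := ℝ))
    exact FAMA.integrable_real_noncentralChiSq_pow (by positivity) _ measurableSet_Iio K _
  · rw [← setIntegral_congr_fun measurableSet_Ioi hintegrand,
      FAMA.setIntegral_gammaPDFReal_mul hN one_half_pos, ← hxy.real_forall_normPower_lt, houtage]
    simp only [lt_div_iff₀' hP', mul_comm (1 - μ ^ 2) P]
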